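/- For $|q|<1$ write $(q;q)_\infty=\prod_{n\ge 1}(1-q^n)$, and for $x\in\mathbb{R}$ let $(q;q)_\infty^{x}$ denote the branch that is analytic in $|q|<1$ and equal to $1$ at $q=0$. Define the quintic theta functions $$A(q)=q^{1/5}(q;q)_\infty^{-3/5}\sum_{n=-\infty}^{\infty}(-1)^nq^{(5n^2-3n)/2},\qquad B(q)=(q;q)_\infty^{-3/5}\sum_{n=-\infty}^{\infty}(-1)^nq^{(5n^2-n)/2},$$ $$C(q)=\frac{(q^5;q^5)_\infty^{-3/5}}{1+e^{3\pi i/5}}\sum_{n=-\infty}^{\infty}e^{3\pi in/5}q^{(n^2-n)/2},\qquad D(q)=\frac{(q^5;q^5)_\infty^{-3/5}}{1+e^{\pi i/5}}\sum_{n=-\infty}^{\infty}e^{\pi in/5}q^{(n^2-n)/2},$$ where $A(q)$ depends on the choice of the fifth root $q^{1/5}$, and $A(q^5)$ is taken with $(q^5)^{1/5}=q$. Let $\alpha=\frac{1+\sqrt5}{2}$ and $\beta=\frac{1-\sqrt5}{2}$. Then for every complex $q$ with $|q|<1$ (and every choice of $q^{1/5}$) $$C^5(q)=B^5(q)-\alpha^5A^5(q),\qquad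 D^5(q)=B^5(q)-\beta^5A^5(q),$$ $$C(q)=B(q^5)-\alpha A(q^5),\qquad D(q)=B(q^5)-\beta A(q^5).$$ Now let $0<|q|<1$, fix a tenth root $q^{1/10}$ of $q$, and let all powers $q^{k/10}$ with $k\in\mathbb{Z}$ be the corresponding powers of it. Then $A(q)\neq0$ and $B(q)\ne 0$. Put $t=A(q)/B(q)$ (the Rogers–Ramanujan continued fraction). As a function of $s=q^{1/10}$, $t$ has on $0<|s|<1$ a continuous square root $\sqrt t$ with $\sqrt t/s\to1$ as $s\to0$; let $\sqrt t$ denote any such square root, and put $\sqrt{(q;q)_\infty/(q^5;q^5)_\infty}=(q;q)_\infty^{1/2}/(q^5;q^5)_\infty^{1/2}$. Then the following four identities of Ramanujan hold, where $\gamma=\alpha$ or $\gamma=\beta$: $$\text{(L}_\gamma)\quad\frac1{\sqrt t}-\gamma\sqrt t=q^{-1/10}\sqrt{\frac{(q;q)_\infty}{(q^5;q^5)_\infty}}\prod_{n=1}^\infty\frac1{1+\gamma q^{n/5}+q^{2n/5}},$$ $$\text{(Q}_\gamma)\quad\Bigl(\frac1{\sqrt t}\Bigr)^5-(\gamma\sqrt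 t)^5=q^{-1/2}\sqrt{\frac{(q;q)_\infty}{(q^5;q^5)_\infty}}\prod_{n=1}^\infty\frac1{(1+\gamma q^{n}+q^{2n})^5}.$$ Moreover, at each such $q$, the identity $C^5(q)=B^5(q)-\alpha^5A^5(q)$ is equivalent to $(\mathrm Q_\alpha)$, $D^5(q)=B^5(q)-\beta^5A^5(q)$ to $(\mathrm Q_\beta)$, $C(q^{1/5})=B(q)-\alpha A(q)$ to $(\mathrm L_\alpha)$, and $D(q^{1/5})=B(q)-\beta A(q)$ to $(\mathrm L_\beta)$. -/

import Mathlib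

open Filter Topology

noncomputable section

/-- The power `(q;q)_∞ ^ x`, where `(q;q)_∞ = ∏_{n ≥ 1} (1 - q ^ n)` and `‖q‖ < 1`: the branch
that is analytic in `q` on the unit disc and equals `1` at `q = 0`. It is obtained by taking the
principal power of each factor `1 - q ^ n` (these factors have positive real part). -/
def eulerPow (q x : ℂ) : ℂ :=
  Complex.exp (x * ∑' n : ℕ, Complex.log (1 - q ^ (n + 1)))

/-- For `x = 1` this is `(q;q)_∞ = lim_n (1 - q) (1 - q ^ 2) ⋯ (1 - q ^ n)`. -/
theorem tendsto_eulerPow_one (q : ℂ) (hq : ‖q‖ < 1) :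
    Tendsto (fun N : ℕ => ∏ n ∈ Finset.range N, (1 - q ^ (n + 1))) atTop (𝓝 (eulerPow q 1)) := by
  have hs : Summable (fun n : ℕ => -q ^ (n + 1)) :=
    ((summable_geometric_of_norm_lt_one hq).mul_left q).neg.congr fun n => by ring
  have hl : Summable (fun n : ℕ => Complex.log (1 - q ^ (n + 1))) := by
    simpa [sub_eq_add_neg] using Complex.summable_log_one_add_of_summable hs
  have h := (Complex.continuous_exp.tendsto _).comp hl.hasSum.tendsto_sum_nat
  rw [eulerPow, one_mul]
  refine h.congr fun N => ?_
  simp only [Function.comp, Complex.exp_sum]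
  refine Finset.prod_congr rfl fun n _ => Complex.exp_log fun h0 => ?_
  have h1 : ‖q ^ (n + 1)‖ < 1 := by
    rw [norm_pow]; exact pow_lt_one₀ (norm_nonneg q) hq n.succ_ne_zero
  rw [← sub_eq_zero.mp h0, norm_one] at h1
  exact lt_irrefl _ h1

/-- The powers of `(q;q)_∞` are multiplicative in the exponent. -/
theorem eulerPow_add (q x y : ℂ) : eulerPow q (x + y) = eulerPow q x * eulerPow q y := by
  simp only [eulerPow, add_mul, Complex.exp_add]

/-- `A(q) = q^{1/5} (q;q)_∞^{-3/5} ∑_{n ∈ ℤ} (-1)^n q^{(5n² - 3n)/2}`. Because of the factor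
`q^{1/5}` it depends on a choice of a fifth root of `q`: `quinticA r` is the value of `A`
at `q = r ^ 5` for the choice `q^{1/5} = r`. (The division in the exponent is exact.) -/
def quinticA (r : ℂ) : ℂ :=
  r * eulerPow (r ^ 5) (-3 / 5) * ∑' n : ℤ, (-1 : ℂ) ^ n * (r ^ 5) ^ ((5 * n ^ 2 - 3 * n) / 2)

/-- `B(q) = (q;q)_∞^{-3/5} ∑_{n ∈ ℤ} (-1)^n q^{(5n² - n)/2}`. -/
def quinticB (q : ℂ) : ℂ :=
  eulerPow q (-3 / 5) * ∑' n : ℤ, (-1 : ℂ) ^ n * q ^ ((5 * n ^ 2 - n) / 2)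

/-- `C(q) = (q⁵;q⁵)_∞^{-3/5} / (1 + e^{3πi/5}) ∑_{n ∈ ℤ} e^{3πin/5} q^{(n² - n)/2}`. -/
def quinticC (q : ℂ) : ℂ :=
  eulerPow (q ^ 5) (-3 / 5) / (1 + Complex.exp (3 * Real.pi * Complex.I / 5)) *
    ∑' n : ℤ, Complex.exp (3 * Real.pi * Complex.I * n / 5) * q ^ ((n ^ 2 - n) / 2)

/-- `D(q) = (q⁵;q⁵)_∞^{-3/5} / (1 + e^{πi/5}) ∑_{n ∈ ℤ} e^{πin/5} q^{(n² - n)/2}`. -/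
def quinticD (q : ℂ) : ℂ :=
  eulerPow (q ^ 5) (-3 / 5) / (1 + Complex.exp (Real.pi * Complex.I / 5)) *
    ∑' n : ℤ, Complex.exp (Real.pi * Complex.I * n / 5) * q ^ ((n ^ 2 - n) / 2)

/-- The quotient `t = A(q) / B(q)` (the Rogers–Ramanujan continued fraction) at `q = r ^ 5`, `q^{1/5} = r`. -/
def rrT (r : ℂ) : ℂ := quinticA r / quinticB (r ^ 5)

/-- In Ramanujan's identities the variable is `s = q^{1/10}`, so that `q^{1/5} = s ^ 2`,
`q^{1/2} = s ^ 5`, `q = s ^ 10`. `IsSqrtT w` says that `w s` is the branch of `√t` which is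
continuous for `0 < ‖s‖ < 1` and asymptotic to `q^{1/10} = s` as `s → 0`. -/
def IsSqrtT (w : ℂ → ℂ) : Prop :=
  ContinuousOn w {s | 0 < ‖s‖ ∧ ‖s‖ < 1} ∧
  (∀ s : ℂ, 0 < ‖s‖ → ‖s‖ < 1 → w s ^ 2 = rrT (s ^ 2)) ∧
  Tendsto (fun s => w s / s) (𝓝[≠] 0) (𝓝 1)

/-- The identity
`1/√t - γ √t = q^{-1/10} √((q;q)_∞ / (q⁵;q⁵)_∞) ∏_{n ≥ 1} 1 / (1 + γ q^{n/5} + q^{2n/5})`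
at `q = s ^ 10`, where `w` is the value of `√t`. -/
def RamanujanLinear (γ s w : ℂ) : Prop :=
  1 / w - γ * w =
    s⁻¹ * (eulerPow (s ^ 10) (1 / 2) / eulerPow ((s ^ 10) ^ 5) (1 / 2)) *
      ∏' n : ℕ, 1 / (1 + γ * (s ^ 2) ^ (n + 1) + (s ^ 2) ^ (2 * (n + 1)))

/-- The identity
`(1/√t)⁵ - (γ √t)⁵ = q^{-1/2} √((q;q)_∞ / (q⁵;q⁵)_∞) ∏_{n ≥ 1} 1 / (1 + γ qⁿ + q^{2n})⁵`
at `q = s ^ 10`, where `w` is the value of `√t`. -/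
def RamanujanQuintic (γ s w : ℂ) : Prop :=
  (1 / w) ^ 5 - (γ * w) ^ 5 =
    (s ^ 5)⁻¹ * (eulerPow (s ^ 10) (1 / 2) / eulerPow ((s ^ 10) ^ 5) (1 / 2)) *
      ∏' n : ℕ, 1 / (1 + γ * (s ^ 10) ^ (n + 1) + (s ^ 10) ^ (2 * (n + 1))) ^ 5

end

/-! Treat `C` and `D` as one function `quinticTheta ζ`, with `ζ` a primitive tenth root of unity and
`γ = 1 - ζ - ζ⁻¹`; the two choices of `ζ` give `γ = α` and `γ = β`.

The linear identity is a five-dissection of `∑ ζⁿ q^{n(n-1)/2}`. Since `ζ⁵ = -1`, the classes 0 and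
1 modulo 5 give the series of `B`, the classes 2 and 4 that of `A`, and class 3 cancels against
itself (`IsQuinticPair.tsum_thetaTerm`).

The quintic identity comes from multiplying the linear ones at the points `ωᵏx`, `ω = -ζ` a
primitive fifth root of unity. As `A` picks up the factor `ωᵏ` and `B` is unchanged, the right sides
multiply to `B⁵ - γ⁵A⁵`. For the left sides, the Jacobi triple product turns `quinticTheta ζ q` into
`(q⁵;q⁵)^{2/5} / ∏(1 + γqⁿ + q²ⁿ)`, and such products over all rotations collapse to a fifth power
at `x⁵` (`prod_qprod_rotate`).

For Ramanujan's forms, the triple product also evaluates `A B` as an explicit zero-free product with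
an explicit square root `sqrtAB`. Then `√t = A / √(AB)` and `1/√t = B / √(AB)`, so each identity is
one of the theta identities divided by `√(AB)` or its fifth power. -/

noncomputable section

/-! ### Infinite products and powers of `(q;q)_∞` -/

/-- The infinite product `∏ₙ (1 + z qⁿ) = (-z; q)_∞`. -/
def qprod (z q : ℂ) : ℂ := ∏' n : ℕ, (1 + z * q ^ n)

theorem multipliable_qprod (z : ℂ) {q : ℂ} (hq : ‖q‖ < 1) :
    Multipliable fun n : ℕ => 1 + z * q ^ n :=
  multipliable_one_add_of_summable ((summable_geometric_of_norm_lt_one hq).mul_left z).norm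

theorem tendsto_qprod (z : ℂ) {q : ℂ} (hq : ‖q‖ < 1) :
    Tendsto (fun N : ℕ => ∏ n ∈ Finset.range N, (1 + z * q ^ n)) atTop (𝓝 (qprod z q)) :=
  (multipliable_qprod z hq).hasProd.tendsto_prod_nat

theorem one_sub_pow_ne_zero {q : ℂ} (hq : ‖q‖ < 1) (n : ℕ) : 1 - q ^ (n + 1) ≠ 0 := by
  intro h0
  have h1 : ‖q ^ (n + 1)‖ < 1 := by
    rw [norm_pow]; exact pow_lt_one₀ (norm_nonneg q) hq n.succ_ne_zero
  rw [← sub_eq_zero.mp h0, norm_one] at h1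
  exact lt_irrefl _ h1

theorem eulerPow_ne_zero (q x : ℂ) : eulerPow q x ≠ 0 := Complex.exp_ne_zero _

theorem eulerPow_nsmul (q x : ℂ) (n : ℕ) : eulerPow q (n * x) = eulerPow q x ^ n := by
  rw [eulerPow, eulerPow, ← Complex.exp_nat_mul, mul_assoc]

/-! ### The Jacobi triple product -/

/-- `1 / (q; q)_n`, extended by zero to negative `n`. -/
def invQFactorial (q : ℂ) (n : ℤ) : ℂ :=
  if 0 ≤ n then (∏ i ∈ Finset.range n.toNat, (1 - q ^ (i + 1)))⁻¹ else 0

/-- Extension by zero keeps the recurrence valid on all of `ℤ`: at `n = 0` the factor `1 - q⁰`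
vanishes. Sums over `k : ℤ` can therefore be shifted without boundary terms. -/
theorem invQFactorial_sub_one {q : ℂ} (hq : ‖q‖ < 1) (n : ℤ) :
    invQFactorial q (n - 1) = (1 - q ^ n) * invQFactorial q n := by
  rcases lt_trichotomy n 0 with h | rfl | h
  · rw [invQFactorial, invQFactorial, if_neg (by omega), if_neg (by omega), mul_zero]
  · simp [invQFactorial]
  · obtain ⟨m, rfl⟩ : ∃ m : ℕ, n = m + 1 := ⟨(n - 1).toNat, by omega⟩
    rw [invQFactorial, invQFactorial, if_pos (by omega), if_pos (by omega)]
    have h1 : ((m : ℤ) + 1 - 1).toNat = m := by omega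
    have h2 : ((m : ℤ) + 1).toNat = m + 1 := by omega
    have h3 : q ^ ((m : ℤ) + 1) = q ^ (m + 1) := by exact_mod_cast rfl
    rw [h1, h2, h3, Finset.prod_range_succ, mul_inv, mul_comm _ (1 - q ^ (m + 1))⁻¹,
      mul_inv_cancel_left₀ (one_sub_pow_ne_zero hq m)]

theorem tendsto_invQFactorial {q : ℂ} (hq : ‖q‖ < 1) :
    Tendsto (invQFactorial q) atTop (𝓝 (eulerPow q 1)⁻¹) := by
  have h := (tendsto_eulerPow_one q hq).inv₀ (eulerPow_ne_zero q 1)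
  have h2 : Tendsto Int.toNat atTop atTop :=
    tendsto_atTop.2 fun b => (eventually_ge_atTop (b : ℤ)).mono fun n hn => by omega
  refine (h.comp h2).congr' ?_
  filter_upwards [eventually_ge_atTop 0] with n hn
  simp [invQFactorial, hn]

theorem exists_norm_invQFactorial_le {q : ℂ} (hq : ‖q‖ < 1) :
    ∃ M : ℝ, 0 ≤ M ∧ ∀ n, ‖invQFactorial q n‖ ≤ M := by
  have h := (tendsto_eulerPow_one q hq).inv₀ (eulerPow_ne_zero q 1)
  obtain ⟨M, hM⟩ := (Metric.isBounded_range_of_tendsto _ h).exists_norm_le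
  have hM0 : 0 ≤ M := (norm_nonneg _).trans (hM _ ⟨0, rfl⟩)
  refine ⟨M, hM0, fun n => ?_⟩
  rw [invQFactorial]
  split_ifs
  · exact hM _ ⟨n.toNat, rfl⟩
  · simpa using hM0

/-- The general term of the theta series `∑ₙ zⁿ q^{n(n-1)/2}`. -/
def thetaTerm (q z : ℂ) (n : ℤ) : ℂ := z ^ n * q ^ ((n ^ 2 - n) / 2)

theorem triangle_succ (n : ℤ) : ((n + 1) ^ 2 - (n + 1)) / 2 = (n ^ 2 - n) / 2 + n := by
  have : (n + 1) ^ 2 = n ^ 2 + 2 * n + 1 := by ring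
  omega

theorem thetaTerm_succ {q z : ℂ} (hq : q ≠ 0) (hz : z ≠ 0) (n : ℤ) :
    thetaTerm q z (n + 1) = z * q ^ n * thetaTerm q z n := by
  rw [thetaTerm, thetaTerm, triangle_succ, zpow_add₀ hq, zpow_add_one₀ hz]
  ring

theorem thetaTerm_ne_zero {q z : ℂ} (hq : q ≠ 0) (hz : z ≠ 0) (n : ℤ) : thetaTerm q z n ≠ 0 :=
  mul_ne_zero (zpow_ne_zero _ hz) (zpow_ne_zero _ hq)

theorem summable_thetaTerm_nat {q z : ℂ} (hq : ‖q‖ < 1) (hq0 : q ≠ 0) (hz : z ≠ 0) :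
    Summable fun n : ℕ => thetaTerm q z n := by
  refine summable_of_ratio_test_tendsto_lt_one (l := 0) zero_lt_one
    (.of_forall fun n => thetaTerm_ne_zero hq0 hz n) ?_
  have h : Tendsto (fun n : ℕ => ‖z‖ * ‖q‖ ^ n) atTop (𝓝 0) := by
    simpa using (tendsto_pow_atTop_nhds_zero_of_lt_one (norm_nonneg q) hq).const_mul ‖z‖
  refine h.congr fun n => ?_
  have h1 := thetaTerm_succ hq0 hz n
  push_cast
  rw [h1, norm_mul, mul_div_cancel_right₀ _ (norm_ne_zero_iff.2 (thetaTerm_ne_zero hq0 hz n))]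
  simp

/-- Reflection reduces summability over the negative integers to the one-sided case with another
`z`. -/
theorem thetaTerm_neg {q z : ℂ} (hq : q ≠ 0) (n : ℤ) :
    thetaTerm q z (-n) = thetaTerm q (z⁻¹ * q) n := by
  have : ((-n) ^ 2 - -n) / 2 = n + (n ^ 2 - n) / 2 := by
    rw [neg_sq]; omega
  rw [thetaTerm, thetaTerm, this, zpow_add₀ hq, mul_zpow, inv_zpow, zpow_neg, mul_assoc]

theorem summable_thetaTerm {q z : ℂ} (hq : ‖q‖ < 1) (hq0 : q ≠ 0) (hz : z ≠ 0) :
    Summable (thetaTerm q z) := by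
  refine Summable.of_nat_of_neg (summable_thetaTerm_nat hq hq0 hz) ?_
  simp only [thetaTerm_neg hq0]
  exact summable_thetaTerm_nat hq hq0 (mul_ne_zero (inv_ne_zero hz) hq0)

theorem norm_thetaTerm_mul_le {q z : ℂ} {M : ℝ} (hM0 : 0 ≤ M)
    (hM : ∀ n, ‖invQFactorial q n‖ ≤ M) (a b k : ℤ) :
    ‖thetaTerm q z k * (invQFactorial q (a - k) * invQFactorial q (b + k))‖ ≤
      ‖thetaTerm q z k‖ * (M * M) := by
  rw [norm_mul, norm_mul]
  gcongr <;> exact hM _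

theorem summable_thetaTerm_mul {q z : ℂ} (hq : ‖q‖ < 1) (hq0 : q ≠ 0) (hz : z ≠ 0) (a b : ℤ) :
    Summable fun k =>
      thetaTerm q z k * (invQFactorial q (a - k) * invQFactorial q (b + k)) := by
  obtain ⟨M, hM0, hM⟩ := exists_norm_invQFactorial_le hq
  exact .of_norm_bounded ((summable_thetaTerm hq hq0 hz).norm.mul_right (M * M))
    (norm_thetaTerm_mul_le hM0 hM a b)

/-- A `q`-Pascal rule: with `X = q^(a+1-k)` and `Y = q^(b+k)`, write `1 - XY = (1 - X) + X(1 - Y)`.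
The first part lowers one inverse factorial, the second the other, after a shift of `k` that
produces `z q^a`. -/
theorem tsum_thetaTerm_mul_succ_left {q z : ℂ} (hq : ‖q‖ < 1) (hq0 : q ≠ 0) (hz : z ≠ 0)
    (a b : ℤ) :
    (1 - q ^ (a + b + 1)) *
        ∑' k, thetaTerm q z k * (invQFactorial q (a + 1 - k) * invQFactorial q (b + k)) =
      (1 + z * q ^ a) *
        ∑' k, thetaTerm q z k * (invQFactorial q (a - k) * invQFactorial q (b + k)) := by
  have hs := summable_thetaTerm_mul hq hq0 hz a b
  have hs' := ((Equiv.subRight (1 : ℤ)).summable_iff).2 (hs.mul_left (z * q ^ a))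
  simp only [Function.comp_def] at hs'
  rw [add_mul, one_mul, ← tsum_mul_left, ← tsum_mul_left,
    ← (Equiv.subRight (1 : ℤ)).tsum_eq
      (fun k => z * q ^ a * (thetaTerm q z k * (invQFactorial q (a - k) * invQFactorial q (b + k)))),
    ← hs.tsum_add hs']
  refine tsum_congr fun k => ?_
  have h1 := invQFactorial_sub_one hq (a + 1 - k)
  have h2 := invQFactorial_sub_one hq (b + k)
  have h3 := thetaTerm_succ hq0 hz (k - 1)
  have h4 : q ^ a = q ^ (k - 1) * q ^ (a + 1 - k) := by rw [← zpow_add₀ hq0]; ring_nf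
  have h5 : q ^ (a + b + 1) = q ^ (a + 1 - k) * q ^ (b + k) := by rw [← zpow_add₀ hq0]; ring_nf
  rw [sub_add_cancel] at h3
  rw [show a + 1 - k - 1 = a - k by ring] at h1
  simp only [Equiv.subRight_apply]
  rw [show a - (k - 1) = a + 1 - k by ring, show b + (k - 1) = b + k - 1 by ring,
    h1, h2, h4, h5, h3]
  ring

/-- The mirror rule, from `1 - XY = (1 - Y) + Y(1 - X)` with `X = q^(a-k)`, `Y = q^(b+1+k)` and the
opposite shift. -/
theorem tsum_thetaTerm_mul_succ_right {q z : ℂ} (hq : ‖q‖ < 1) (hq0 : q ≠ 0) (hz : z ≠ 0)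
    (a b : ℤ) :
    (1 - q ^ (a + b + 1)) *
        ∑' k, thetaTerm q z k * (invQFactorial q (a - k) * invQFactorial q (b + 1 + k)) =
      (1 + z⁻¹ * q ^ (b + 1)) *
        ∑' k, thetaTerm q z k * (invQFactorial q (a - k) * invQFactorial q (b + k)) := by
  have hs := summable_thetaTerm_mul hq hq0 hz a b
  have hs' := ((Equiv.addRight (1 : ℤ)).summable_iff).2 (hs.mul_left (z⁻¹ * q ^ (b + 1)))
  simp only [Function.comp_def] at hs'
  rw [add_mul, one_mul, ← tsum_mul_left, ← tsum_mul_left,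
    ← (Equiv.addRight (1 : ℤ)).tsum_eq
      (fun k => z⁻¹ * q ^ (b + 1) *
        (thetaTerm q z k * (invQFactorial q (a - k) * invQFactorial q (b + k)))),
    ← hs.tsum_add hs']
  refine tsum_congr fun k => ?_
  have h1 := invQFactorial_sub_one hq (a - k)
  have h2 := invQFactorial_sub_one hq (b + 1 + k)
  have h3 := thetaTerm_succ hq0 hz k
  have h4 : q ^ (b + 1 + k) = q ^ (b + 1) * q ^ k := by rw [← zpow_add₀ hq0]
  have h5 : q ^ (a + b + 1) = q ^ (a - k) * q ^ (b + 1 + k) := by rw [← zpow_add₀ hq0]; ring_nf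
  rw [show b + 1 + k - 1 = b + k by ring] at h2
  simp only [Equiv.coe_addRight]
  rw [show a - (k + 1) = a - k - 1 by ring, show b + (k + 1) = b + 1 + k by ring,
    h1, h2, h5, h4, h3]
  field_simp
  ring

/-- The finite form of the Jacobi triple product. -/
theorem finite_triple_product {q z : ℂ} (hq : ‖q‖ < 1) (hq0 : q ≠ 0) (hz : z ≠ 0) (a b : ℕ) :
    (∏ i ∈ Finset.range a, (1 + z * q ^ i)) * ∏ i ∈ Finset.range b, (1 + z⁻¹ * q * q ^ i) =
      (∏ i ∈ Finset.range (a + b), (1 - q ^ (i + 1))) *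
        ∑' k : ℤ, thetaTerm q z k * (invQFactorial q (a - k) * invQFactorial q (b + k)) := by
  induction b with
  | zero =>
    induction a with
    | zero =>
      -- For `a = b = 0` only `k = 0` survives, as `-k` and `k` must both be nonnegative.
      rw [tsum_eq_single 0]
      · simp [thetaTerm, invQFactorial]
      · intro k hk
        rcases lt_or_gt_of_ne hk with h | h
        · simp [invQFactorial, not_le.2 h]
        · simp [invQFactorial, h]
    | succ a ih =>
      have h := tsum_thetaTerm_mul_succ_left hq hq0 hz a 0
      have h3 : q ^ ((a : ℤ) + 0 + 1) = q ^ (a + 1) := by rw [add_zero]; exact_mod_cast rfl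
      rw [h3, zpow_natCast] at h
      simp only [Nat.cast_zero, Nat.cast_add, Nat.cast_one, add_zero] at ih ⊢
      rw [Finset.prod_range_succ, Finset.prod_range_succ, mul_right_comm, ih, mul_assoc, mul_assoc, h]
      ring
  | succ b ih =>
    have h := tsum_thetaTerm_mul_succ_right hq hq0 hz a b
    have h3 : q ^ ((a : ℤ) + b + 1) = q ^ (a + b + 1) := by exact_mod_cast rfl
    have h4 : q ^ ((b : ℤ) + 1) = q * q ^ b := by rw [zpow_add_one₀ hq0, zpow_natCast, mul_comm]
    rw [h3, h4, ← mul_assoc z⁻¹] at h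
    rw [← add_assoc, Finset.prod_range_succ, Finset.prod_range_succ _ (a + b), ← mul_assoc, ih,
      Nat.cast_succ, mul_assoc _ (1 - q ^ (a + b + 1)), h]
    ring

/-- The Jacobi triple product identity. -/
theorem jacobi_triple_product {q z : ℂ} (hq : ‖q‖ < 1) (hq0 : q ≠ 0) (hz : z ≠ 0) :
    ∑' n : ℤ, thetaTerm q z n = eulerPow q 1 * (qprod z q * qprod (z⁻¹ * q) q) := by
  obtain ⟨M, hM0, hM⟩ := exists_norm_invQFactorial_le hq
  have hE := eulerPow_ne_zero q 1
  have hcast : Tendsto (fun n : ℕ => (n : ℤ)) atTop atTop := tendsto_natCast_atTop_atTop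
  have hsum : Tendsto (fun n : ℕ => ∑' k : ℤ, thetaTerm q z k *
      (invQFactorial q (n - k) * invQFactorial q (n + k))) atTop
      (𝓝 (∑' k : ℤ, thetaTerm q z k * ((eulerPow q 1)⁻¹ * (eulerPow q 1)⁻¹))) := by
    refine tendsto_tsum_of_dominated_convergence
      ((summable_thetaTerm hq hq0 hz).norm.mul_right (M * M)) (fun k => ?_)
      (.of_forall fun n k => norm_thetaTerm_mul_le hM0 hM n n k)
    refine Tendsto.const_mul _ (Tendsto.mul ?_ ?_)
    · exact (tendsto_invQFactorial hq).comp (tendsto_atTop_add_const_right _ (-k) hcast)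
    · exact (tendsto_invQFactorial hq).comp (tendsto_atTop_add_const_right _ k hcast)
  have hdouble : Tendsto (fun n : ℕ => n + n) atTop atTop :=
    tendsto_atTop_mono (fun n => Nat.le_add_left n n) tendsto_id
  have hR := ((tendsto_eulerPow_one q hq).comp hdouble).mul hsum
  have hL := (tendsto_qprod z hq).mul (tendsto_qprod (z⁻¹ * q) hq)
  have h := tendsto_nhds_unique (hL.congr fun n => finite_triple_product hq hq0 hz n n) hR
  rw [h, tsum_mul_right]
  field_simp

theorem qprod_eq_mul (z : ℂ) {q : ℂ} (hq : ‖q‖ < 1) :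
    qprod z q = (1 + z) * qprod (z * q) q := by
  refine tendsto_nhds_unique ((tendsto_qprod z hq).comp (tendsto_add_atTop_nat 1))
    (((tendsto_qprod (z * q) hq).const_mul (1 + z)).congr fun N => ?_)
  simp only [Function.comp, Finset.prod_range_succ', pow_zero, mul_one]
  rw [mul_comm]
  congr 1
  exact Finset.prod_congr rfl fun i _ => by ring

/-! ### Quintic pairs and the product formula for `C` and `D` -/

/-- The product `∏ₙ (1 + γ qⁿ + q²ⁿ)` over `n ≥ 1`. -/
def trinomialProd (γ q : ℂ) : ℂ := ∏' n : ℕ, (1 + γ * q ^ (n + 1) + q ^ (2 * (n + 1)))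

theorem hasProd_trinomialProd {z : ℂ} (hz : z ≠ 0) {q : ℂ} (hq : ‖q‖ < 1) :
    HasProd (fun n : ℕ => 1 + (z + z⁻¹) * q ^ (n + 1) + q ^ (2 * (n + 1)))
      (qprod (z * q) q * qprod (z⁻¹ * q) q) := by
  convert (multipliable_qprod (z * q) hq).hasProd.mul (multipliable_qprod (z⁻¹ * q) hq).hasProd
    using 2 with n
  · field_simp
    ring
  · rfl
  · rfl

theorem trinomialProd_eq {z γ : ℂ} (hz : z ≠ 0) (hγ : γ = z + z⁻¹) {q : ℂ} (hq : ‖q‖ < 1) :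
    trinomialProd γ q = qprod (z * q) q * qprod (z⁻¹ * q) q := by
  subst hγ
  exact (hasProd_trinomialProd hz hq).tprod_eq

theorem tendsto_trinomialProd {z γ : ℂ} (hz : z ≠ 0) (hγ : γ = z + z⁻¹) {q : ℂ} (hq : ‖q‖ < 1) :
    Tendsto (fun N : ℕ => ∏ n ∈ Finset.range N, (1 + γ * q ^ (n + 1) + q ^ (2 * (n + 1)))) atTop
      (𝓝 (trinomialProd γ q)) := by
  rw [trinomialProd_eq hz hγ hq]
  subst hγ
  exact (hasProd_trinomialProd hz hq).tendsto_prod_nat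

theorem norm_pow_five_lt_one {q : ℂ} (hq : ‖q‖ < 1) : ‖q ^ 5‖ < 1 := by
  rw [norm_pow]; exact pow_lt_one₀ (norm_nonneg q) hq (by norm_num)

/-- The parameters of the quintic theta functions: `ζ` is a primitive tenth root of unity and
`γ = 1 - ζ - ζ⁻¹`. -/
structure IsQuinticPair (ζ γ : ℂ) : Prop where
  cyclotomic : ζ ^ 4 - ζ ^ 3 + ζ ^ 2 - ζ + 1 = 0
  eq : γ = 1 - ζ + ζ ^ 4

namespace IsQuinticPair

theorem pow_five {ζ γ : ℂ} (h : IsQuinticPair ζ γ) : ζ ^ 5 = -1 := by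
  linear_combination (ζ + 1) * h.cyclotomic

theorem ne_zero {ζ γ : ℂ} (h : IsQuinticPair ζ γ) : ζ ≠ 0 := by
  rintro rfl
  simpa using h.cyclotomic

theorem one_add_ne_zero {ζ γ : ℂ} (h : IsQuinticPair ζ γ) : 1 + ζ ≠ 0 := by
  intro h0
  have h1 := h.cyclotomic
  rw [show ζ = -1 by linear_combination h0] at h1
  norm_num at h1

theorem inv_eq {ζ γ : ℂ} (h : IsQuinticPair ζ γ) : ζ⁻¹ = -ζ ^ 4 :=
  inv_eq_of_mul_eq_one_right (by linear_combination -h.pow_five)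

theorem inv_neg_sq {ζ γ : ℂ} (h : IsQuinticPair ζ γ) : (-ζ ^ 2)⁻¹ = ζ ^ 3 :=
  inv_eq_of_mul_eq_one_right (by linear_combination -h.pow_five)

theorem one_sub_eq {ζ γ : ℂ} (h : IsQuinticPair ζ γ) : 1 - γ = ζ + ζ⁻¹ := by
  rw [h.inv_eq, h.eq]; ring

theorem eq_add_inv {ζ γ : ℂ} (h : IsQuinticPair ζ γ) : γ = -ζ ^ 2 + (-ζ ^ 2)⁻¹ := by
  rw [h.inv_neg_sq, h.eq]; linear_combination h.cyclotomic

theorem sq_eq {ζ γ : ℂ} (h : IsQuinticPair ζ γ) : γ ^ 2 = γ + 1 := by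
  have h1 := h.cyclotomic
  have h2 := h.eq
  grind

/-- Factor by factor this is `(1 - y)(1 + γy + y²)(1 + (1-γ)y + y²) = 1 - y⁵`, which uses only `γ² =
γ + 1`. It also shows that neither trinomial product vanishes. -/
theorem trinomialProd_mul {ζ γ : ℂ} (h : IsQuinticPair ζ γ) {q : ℂ} (hq : ‖q‖ < 1) :
    trinomialProd γ q * trinomialProd (1 - γ) q * eulerPow q 1 = eulerPow (q ^ 5) 1 := by
  have hz2 : -ζ ^ 2 ≠ 0 := neg_ne_zero.2 (pow_ne_zero _ h.ne_zero)
  refine tendsto_nhds_unique ((((tendsto_trinomialProd hz2 h.eq_add_inv hq).mul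
    (tendsto_trinomialProd h.ne_zero h.one_sub_eq hq)).mul (tendsto_eulerPow_one q hq)).congr
      fun N => ?_) (tendsto_eulerPow_one _ (norm_pow_five_lt_one hq))
  rw [← Finset.prod_mul_distrib, ← Finset.prod_mul_distrib]
  refine Finset.prod_congr rfl fun n _ => ?_
  rw [← pow_mul, mul_comm 5, mul_comm 2, pow_mul, pow_mul]
  generalize q ^ (n + 1) = y
  linear_combination (-y ^ 2 + y ^ 3) * h.sq_eq

theorem trinomialProd_ne_zero {ζ γ : ℂ} (h : IsQuinticPair ζ γ) {q : ℂ} (hq : ‖q‖ < 1) :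
    trinomialProd γ q ≠ 0 := by
  intro h0
  have h1 := h.trinomialProd_mul hq
  rw [h0, zero_mul, zero_mul] at h1
  exact eulerPow_ne_zero _ _ h1.symm

end IsQuinticPair

/-- The common form of the functions `C` and `D`:
`(q⁵;q⁵)_∞^{-3/5} / (1 + ζ) ∑ₙ ζⁿ q^{(n² - n)/2}`. -/
def quinticTheta (ζ q : ℂ) : ℂ :=
  eulerPow (q ^ 5) (-3 / 5) / (1 + ζ) * ∑' n : ℤ, thetaTerm q ζ n

theorem eulerPow_one_eq_qprod {q : ℂ} (hq : ‖q‖ < 1) : eulerPow q 1 = qprod (-q) q := by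
  refine tendsto_nhds_unique (tendsto_eulerPow_one q hq) ((tendsto_qprod (-q) hq).congr fun N => ?_)
  exact Finset.prod_congr rfl fun n _ => by ring

theorem zero_zpow_triangle {n : ℤ} (h0 : n ≠ 0) (h1 : n ≠ 1) :
    (0 : ℂ) ^ ((n ^ 2 - n) / 2) = 0 := by
  refine zero_zpow _ (ne_of_gt ?_)
  have : 2 ≤ n ^ 2 - n := by
    rcases lt_or_gt_of_ne h0 with h | h
    · nlinarith
    · have : 2 ≤ n := by omega
      nlinarith
  omega

namespace IsQuinticPair

theorem quinticTheta_zero {ζ γ : ℂ} (h : IsQuinticPair ζ γ) : quinticTheta ζ 0 = 1 := by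
  have h1 : ∑' n : ℤ, thetaTerm 0 ζ n = 1 + ζ := by
    rw [tsum_eq_sum (s := {0, 1})]
    · rw [Finset.sum_pair (by norm_num)]
      simp [thetaTerm]
    · intro n hn
      simp only [Finset.mem_insert, Finset.mem_singleton, not_or] at hn
      rw [thetaTerm, zero_zpow_triangle hn.1 hn.2, mul_zero]
  rw [quinticTheta, h1, div_mul_cancel₀ _ h.one_add_ne_zero]
  simp [eulerPow]

/-- The triple product naturally yields the trinomial product for the conjugate `1 - γ`;
`trinomialProd_mul` trades it for the reciprocal of the one for `γ`, which is the product in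
Ramanujan's identities. -/
theorem quinticTheta_mul_trinomialProd {ζ γ : ℂ} (h : IsQuinticPair ζ γ)
    {q : ℂ} (hq : ‖q‖ < 1) (hq0 : q ≠ 0) :
    quinticTheta ζ q * trinomialProd γ q = eulerPow (q ^ 5) (2 / 5) := by
  have h1 := h.one_add_ne_zero
  have h2 := h.trinomialProd_mul hq
  rw [trinomialProd_eq h.ne_zero h.one_sub_eq hq] at h2
  rw [quinticTheta, jacobi_triple_product hq hq0 h.ne_zero, qprod_eq_mul ζ hq,
    show (2 / 5 : ℂ) = -3 / 5 + 1 by norm_num, eulerPow_add, ← h2]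
  field_simp

end IsQuinticPair

/-! ### Five-dissection and the linear identities -/

theorem quinticA_zero : quinticA 0 = 0 := by simp [quinticA]

theorem quinticB_zero : quinticB 0 = 1 := by
  have h1 : ∑' n : ℤ, (-1 : ℂ) ^ n * (0 : ℂ) ^ ((5 * n ^ 2 - n) / 2) = 1 := by
    rw [tsum_eq_single 0]
    · simp
    · intro n hn
      rw [zero_zpow _ (ne_of_gt ?_), mul_zero]
      have : 1 ≤ n ^ 2 := by nlinarith [sq_pos_of_ne_zero hn]
      have : 2 ≤ 5 * n ^ 2 - n := by nlinarith [sq_nonneg (n - 1)]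
      omega
  rw [quinticB, h1]
  simp [eulerPow]

/-- Supplies the parity of `n² - n` in linear form, so that `omega` can handle the halved exponents
with `n²` as an atom. -/
theorem exists_sq_eq_two_mul_add (n : ℤ) : ∃ c, n ^ 2 = 2 * c + n := by
  obtain ⟨c, hc⟩ := Int.even_mul_pred_self n
  exact ⟨c, by linear_combination hc⟩

theorem thetaTerm_pow_five_neg {q : ℂ} (hq : q ≠ 0) (n : ℤ) :
    thetaTerm (q ^ 5) (-q) n = (-1 : ℂ) ^ n * q ^ ((5 * n ^ 2 - 3 * n) / 2) := by
  obtain ⟨c, hc⟩ := exists_sq_eq_two_mul_add n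
  rw [thetaTerm, ← zpow_natCast, ← zpow_mul, neg_eq_neg_one_mul, mul_zpow, mul_assoc,
    ← zpow_add₀ hq]
  congr 2
  omega

theorem thetaTerm_pow_five_neg_sq {q : ℂ} (hq : q ≠ 0) (n : ℤ) :
    thetaTerm (q ^ 5) (-q ^ 2) n = (-1 : ℂ) ^ n * q ^ ((5 * n ^ 2 - n) / 2) := by
  obtain ⟨c, hc⟩ := exists_sq_eq_two_mul_add n
  have hpow : ∀ (j : ℕ) (k : ℤ), (q ^ j) ^ k = q ^ (j * k) := fun j k => by
    rw [zpow_mul, zpow_natCast]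
  rw [thetaTerm, neg_eq_neg_one_mul, mul_zpow, mul_assoc, hpow, hpow, ← zpow_add₀ hq]
  congr 2
  omega

theorem quinticA_eq {r : ℂ} (hr : r ≠ 0) :
    quinticA r = r * eulerPow (r ^ 5) (-3 / 5) * ∑' n : ℤ, thetaTerm ((r ^ 5) ^ 5) (-r ^ 5) n := by
  rw [quinticA]
  congr 1
  exact tsum_congr fun n => (thetaTerm_pow_five_neg (pow_ne_zero 5 hr) n).symm

theorem quinticB_eq {q : ℂ} (hq : q ≠ 0) :
    quinticB q = eulerPow q (-3 / 5) * ∑' n : ℤ, thetaTerm (q ^ 5) (-q ^ 2) n := by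
  rw [quinticB]
  congr 1
  exact tsum_congr fun n => (thetaTerm_pow_five_neg_sq hq n).symm

/-- Splitting a bilateral series into the residue classes modulo `5`. -/
theorem tsum_int_mod_five {f : ℤ → ℂ} (hf : Summable f) :
    ∑' n, f n = ∑' m, f (m * 5) + ∑' m, f (m * 5 + 1) + ∑' m, f (m * 5 + 2) + ∑' m, f (m * 5 + 3) +
      ∑' m, f (m * 5 + 4) := by
  let e : Fin 5 × ℤ ≃ ℤ := (Equiv.prodComm _ _).trans (Int.divModEquiv 5).symm
  have he : ∀ (j : Fin 5) (m : ℤ), e (j, m) = m * 5 + j := fun _ _ => rfl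
  have hs : Summable fun p => f (e p) := (e.summable_iff).2 hf
  rw [← e.tsum_eq, hs.tsum_prod, tsum_fintype]
  simp [Fin.sum_univ_five, he]

/-- The five-dissection of the theta series at a primitive tenth root of unity. -/
theorem IsQuinticPair.tsum_thetaTerm {ζ γ : ℂ} (h : IsQuinticPair ζ γ) {q : ℂ} (hq : ‖q‖ < 1)
    (hq0 : q ≠ 0) :
    ∑' n : ℤ, thetaTerm q ζ n =
      (1 + ζ) * ∑' n : ℤ, (-1 : ℂ) ^ n * (q ^ 5) ^ ((5 * n ^ 2 - n) / 2) +
      (ζ ^ 2 - ζ ^ 4) * q * ∑' n : ℤ, (-1 : ℂ) ^ n * (q ^ 5) ^ ((5 * n ^ 2 - 3 * n) / 2) := by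
  have hζ : ∀ m : ℤ, ∀ j : ℕ, ζ ^ (m * 5 + j) = (-1) ^ m * ζ ^ j := fun m j => by
    rw [zpow_add₀ h.ne_zero, mul_comm m, zpow_mul, zpow_natCast]
    congr 2
    exact_mod_cast h.pow_five
  have hq5 : ∀ k : ℤ, (q ^ 5) ^ k = q ^ (5 * k) := fun k => by
    rw [zpow_mul]; norm_cast
  have hneg : ∀ n : ℤ, (-1 : ℂ) ^ (-n) = (-1) ^ n := fun n => by
    rw [zpow_neg, ← inv_zpow, inv_neg_one]
  have t0 : ∑' m : ℤ, thetaTerm q ζ (m * 5) =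
      ∑' n : ℤ, (-1 : ℂ) ^ n * (q ^ 5) ^ ((5 * n ^ 2 - n) / 2) := by
    refine tsum_congr fun m => ?_
    obtain ⟨c, hc⟩ := exists_sq_eq_two_mul_add m
    have h1 := hζ m 0
    rw [Nat.cast_zero, add_zero, pow_zero, mul_one] at h1
    rw [thetaTerm, h1, hq5, show (m * 5) ^ 2 = 25 * m ^ 2 by ring]
    congr 2
    omega
  have t1 : ∑' m : ℤ, thetaTerm q ζ (m * 5 + 1) =
      ζ * ∑' n : ℤ, (-1 : ℂ) ^ n * (q ^ 5) ^ ((5 * n ^ 2 - n) / 2) := by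
    -- Class 1 carries the exponent with `5n² + n`; replacing `m` by `-m` brings it to the form in
    -- `B`.
    rw [← (Equiv.neg ℤ).tsum_eq, ← tsum_mul_left]
    refine tsum_congr fun m => ?_
    obtain ⟨c, hc⟩ := exists_sq_eq_two_mul_add m
    have h1 := hζ (-m) 1
    rw [Nat.cast_one, pow_one, hneg] at h1
    rw [Equiv.neg_apply, thetaTerm, h1, hq5,
      show (-m * 5 + 1) ^ 2 = 25 * m ^ 2 - 10 * m + 1 by ring, mul_comm _ ζ, mul_assoc]
    congr 3
    omega
  have t2 : ∑' m : ℤ, thetaTerm q ζ (m * 5 + 2) =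
      ζ ^ 2 * q * ∑' n : ℤ, (-1 : ℂ) ^ n * (q ^ 5) ^ ((5 * n ^ 2 - 3 * n) / 2) := by
    rw [← (Equiv.neg ℤ).tsum_eq, ← tsum_mul_left]
    refine tsum_congr fun m => ?_
    obtain ⟨c, hc⟩ := exists_sq_eq_two_mul_add m
    have h1 := hζ (-m) 2
    rw [Nat.cast_ofNat, hneg] at h1
    rw [Equiv.neg_apply, thetaTerm, h1, hq5,
      show (-m * 5 + 2) ^ 2 = 25 * m ^ 2 - 20 * m + 4 by ring,
      show (25 * m ^ 2 - 20 * m + 4 - (-m * 5 + 2)) / 2 = 1 + 5 * ((5 * m ^ 2 - 3 * m) / 2) by omega,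
      zpow_add₀ hq0, zpow_one]
    ring
  have t3 : ∑' m : ℤ, thetaTerm q ζ (m * 5 + 3) = 0 := by
    -- The involution `n ↦ 1 - n` preserves `n² - n` and the class of 3, acting by `m ↦ -1 - m`. It
    -- reverses the sign `(-1)^m`, so the sum equals its negative.
    refine self_eq_neg.1 ?_
    conv_lhs => rw [← (Equiv.subLeft (-1 : ℤ)).tsum_eq]
    rw [← tsum_neg]
    refine tsum_congr fun m => ?_
    have h1 := hζ (-1 - m) 3
    have h2 := hζ m 3
    have h3 : (-1 : ℂ) ^ (-1 - m) = -(-1) ^ m := by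
      rw [show -1 - m = -(m + 1) by ring, hneg, zpow_add_one₀ (by norm_num), mul_neg_one]
    rw [Nat.cast_ofNat] at h1 h2
    rw [Equiv.subLeft_apply, thetaTerm, thetaTerm, h1, h2, h3,
      show ((-1 - m) * 5 + 3) ^ 2 - ((-1 - m) * 5 + 3) = (m * 5 + 3) ^ 2 - (m * 5 + 3) by ring]
    ring
  have t4 : ∑' m : ℤ, thetaTerm q ζ (m * 5 + 4) =
      -ζ ^ 4 * q * ∑' n : ℤ, (-1 : ℂ) ^ n * (q ^ 5) ^ ((5 * n ^ 2 - 3 * n) / 2) := by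
    rw [← (Equiv.subRight (1 : ℤ)).tsum_eq, ← tsum_mul_left]
    refine tsum_congr fun m => ?_
    obtain ⟨c, hc⟩ := exists_sq_eq_two_mul_add m
    have h1 := hζ (m - 1) 4
    rw [Nat.cast_ofNat, zpow_sub_one₀ (by norm_num)] at h1
    rw [Equiv.subRight_apply, thetaTerm, h1, hq5,
      show ((m - 1) * 5 + 4) ^ 2 = 25 * m ^ 2 - 10 * m + 1 by ring,
      show (25 * m ^ 2 - 10 * m + 1 - ((m - 1) * 5 + 4)) / 2 = 1 + 5 * ((5 * m ^ 2 - 3 * m) / 2) by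
        omega,
      zpow_add₀ hq0, zpow_one, inv_neg_one]
    ring
  rw [tsum_int_mod_five (summable_thetaTerm hq hq0 h.ne_zero), t0, t1, t2, t3, t4]
  ring

theorem IsQuinticPair.quinticTheta_eq {ζ γ : ℂ} (h : IsQuinticPair ζ γ) {q : ℂ} (hq : ‖q‖ < 1) :
    quinticTheta ζ q = quinticB (q ^ 5) - γ * quinticA q := by
  rcases eq_or_ne q 0 with rfl | hq0
  · rw [h.quinticTheta_zero, quinticA_zero, zero_pow (by norm_num), quinticB_zero]
    ring
  · have h1 := h.one_add_ne_zero
    have h2 : ζ ^ 2 - ζ ^ 4 = -γ * (1 + ζ) := by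
      rw [h.eq]; linear_combination h.pow_five
    rw [quinticTheta, h.tsum_thetaTerm hq hq0, h2, quinticA, quinticB]
    field_simp
    ring

/-! ### Rotation by fifth roots of unity and the quintic identities -/

theorem prod_range_five_mul (f : ℕ → ℂ) (N : ℕ) :
    ∏ i ∈ Finset.range (5 * N), f i =
      ∏ m ∈ Finset.range N, ∏ j ∈ Finset.range 5, f (5 * m + j) := by
  induction N with
  | zero => simp
  | succ N ih => rw [mul_add_one, Finset.prod_range_add, ih, Finset.prod_range_succ _ N]

theorem tendsto_five_mul : Tendsto (fun N : ℕ => 5 * N) atTop atTop :=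
  tendsto_atTop_mono (fun n => Nat.le_mul_of_pos_left n (by norm_num)) tendsto_id

theorem eulerPow_one_eq_prod_qprod {q : ℂ} (hq : ‖q‖ < 1) :
    eulerPow q 1 = ∏ j ∈ Finset.range 5, qprod (-q ^ (j + 1)) (q ^ 5) := by
  refine tendsto_nhds_unique ((tendsto_eulerPow_one q hq).comp tendsto_five_mul)
    ((tendsto_finsetProd _ fun j _ =>
      tendsto_qprod (-q ^ (j + 1)) (norm_pow_five_lt_one hq)).congr fun N => ?_)
  rw [Function.comp, prod_range_five_mul, Finset.prod_comm]
  refine Finset.prod_congr rfl fun m _ => Finset.prod_congr rfl fun j _ => ?_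
  ring

/-- The product formula for `A(q) B(q)`. -/
theorem quinticA_mul_quinticB {r : ℂ} (hr : ‖r‖ < 1) (hr0 : r ≠ 0) :
    quinticA r * quinticB (r ^ 5) =
      r * eulerPow (r ^ 5) (-1 / 5) * eulerPow ((r ^ 5) ^ 5) 1 := by
  rw [quinticA_eq hr0, quinticB_eq (pow_ne_zero 5 hr0)]
  have hq := norm_pow_five_lt_one hr
  have hq0 := pow_ne_zero 5 hr0
  generalize r ^ 5 = q at *
  -- Modulo 5, the triple product for `A` covers the exponents in classes 1 and 4, that for `B`
  -- classes 2 and 3. Class 0 is `(q⁵;q⁵)_∞`, so together they rebuild `(q;q)_∞`.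
  have h := eulerPow_one_eq_prod_qprod hq
  simp only [Finset.prod_range_succ, Finset.prod_range_zero, one_mul, zero_add, pow_one,
    Nat.reduceAdd] at h
  rw [← eulerPow_one_eq_qprod (norm_pow_five_lt_one hq)] at h
  have e1 : (-q)⁻¹ * q ^ 5 = -q ^ 4 := by field_simp
  have e2 : (-q ^ 2)⁻¹ * q ^ 5 = -q ^ 3 := by field_simp
  rw [jacobi_triple_product (norm_pow_five_lt_one hq) (pow_ne_zero 5 hq0) (neg_ne_zero.2 hq0),
    jacobi_triple_product (norm_pow_five_lt_one hq) (pow_ne_zero 5 hq0)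
      (neg_ne_zero.2 (pow_ne_zero 2 hq0)), e1, e2,
    show (-1 / 5 : ℂ) = -3 / 5 + -3 / 5 + 1 by norm_num, eulerPow_add, eulerPow_add, h]
  ring

theorem prod_add_mul_pow_five {v : ℂ} (hv : v ^ 4 + v ^ 3 + v ^ 2 + v + 1 = 0) (b c : ℂ) :
    ∏ k ∈ Finset.range 5, (b + c * v ^ k) = b ^ 5 + c ^ 5 := by
  have h5 : v ^ 5 = 1 := by linear_combination (v - 1) * hv
  -- Conjugate factors are paired; the middle coefficients `v + v⁴` and `v² + v³` have sum and
  -- product `-1`.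
  have h1 : (b + c * v) * (b + c * v ^ 4) = b ^ 2 + b * c * (v + v ^ 4) + c ^ 2 := by
    linear_combination c ^ 2 * h5
  have h2 : (b + c * v ^ 2) * (b + c * v ^ 3) = b ^ 2 + b * c * (-1 - (v + v ^ 4)) + c ^ 2 := by
    linear_combination c ^ 2 * h5 + b * c * hv
  have h3 : (v + v ^ 4) * (-1 - (v + v ^ 4)) = -1 := by
    linear_combination -hv - (2 + v ^ 3) * h5
  simp only [Finset.prod_range_succ, Finset.prod_range_zero, one_mul, pow_zero, pow_one, mul_one]
  linear_combination (b + c) * ((b + c * v ^ 2) * (b + c * v ^ 3)) * h1 +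
    (b + c) * (b ^ 2 + b * c * (v + v ^ 4) + c ^ 2) * h2 + (b + c) * b ^ 2 * c ^ 2 * h3

theorem cyclotomic_five_pow {v : ℂ} (hv : v ^ 4 + v ^ 3 + v ^ 2 + v + 1 = 0) {n : ℕ}
    (hn : ¬5 ∣ n) : (v ^ n) ^ 4 + (v ^ n) ^ 3 + (v ^ n) ^ 2 + v ^ n + 1 = 0 := by
  have h5 : v ^ 5 = 1 := by linear_combination (v - 1) * hv
  have h : v ^ n = v ^ (n % 5) := by
    conv_lhs => rw [← Nat.div_add_mod n 5, pow_add, pow_mul, h5, one_pow, one_mul]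
  rw [h]
  have : n % 5 = 1 ∨ n % 5 = 2 ∨ n % 5 = 3 ∨ n % 5 = 4 := by omega
  rcases this with h | h | h | h <;> rw [h]
  · linear_combination hv
  · linear_combination hv + (v ^ 3 + v) * h5
  · linear_combination hv + (v ^ 7 + v ^ 4 + v ^ 2 + v) * h5
  · linear_combination hv + (v ^ 11 + v ^ 6 + v + v ^ 7 + v ^ 2 + v ^ 3) * h5

/-- The product of `(-u ω^k x; ω^k x)_∞` over the fifth roots of unity `ω^k`. -/
theorem prod_qprod_rotate {u v x : ℂ} (hu : u ^ 5 = -1) (hv : v ^ 4 + v ^ 3 + v ^ 2 + v + 1 = 0)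
    (hx : ‖x‖ < 1) :
    (∏ k ∈ Finset.range 5, qprod (u * (v ^ k * x)) (v ^ k * x)) * eulerPow ((x ^ 5) ^ 5) 1 =
      eulerPow (x ^ 5) 1 * qprod (u * x ^ 5) (x ^ 5) ^ 5 := by
  have h5 : v ^ 5 = 1 := by linear_combination (v - 1) * hv
  have hv1 : ‖v‖ = 1 := Complex.norm_eq_one_of_pow_eq_one h5 (by norm_num)
  have hq := norm_pow_five_lt_one hx
  have hrot : ∀ k : ℕ, ‖v ^ k * x‖ < 1 := fun k => by simpa [hv1] using hx
  have hL := ((tendsto_finsetProd (Finset.range 5) fun k _ =>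
    tendsto_qprod (u * (v ^ k * x)) (hrot k)).comp tendsto_five_mul).mul
      (tendsto_eulerPow_one _ (norm_pow_five_lt_one hq))
  have hR := ((tendsto_eulerPow_one _ hq).comp tendsto_five_mul).mul
    ((tendsto_qprod (u * x ^ 5) hq).pow 5)
  refine tendsto_nhds_unique hL (hR.congr fun N => ?_)
  have hF : ∀ i : ℕ, ∏ k ∈ Finset.range 5, (1 + u * (v ^ k * x) * (v ^ k * x) ^ i) =
      ∏ k ∈ Finset.range 5, (1 + u * x ^ (i + 1) * (v ^ (i + 1)) ^ k) := fun i =>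
    Finset.prod_congr rfl fun k _ => by ring
  -- If 5 does not divide `i + 1`, then `v^(i+1)` is still primitive and the rotated factors
  -- multiply out, by `u⁵ = -1`. Otherwise all five coincide. The classes missed in the first case
  -- are supplied by `((x⁵)⁵;(x⁵)⁵)_∞`.
  have hF1 : ∀ i : ℕ, ¬5 ∣ i + 1 →
      ∏ k ∈ Finset.range 5, (1 + u * x ^ (i + 1) * (v ^ (i + 1)) ^ k) = 1 - (x ^ 5) ^ (i + 1) :=
    fun i hi => by
      rw [prod_add_mul_pow_five (cyclotomic_five_pow hv hi), mul_pow, hu]; ring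
  have hF2 : ∀ m : ℕ,
      ∏ k ∈ Finset.range 5, (1 + u * x ^ (5 * m + 4 + 1) * (v ^ (5 * m + 4 + 1)) ^ k) =
        (1 + u * x ^ 5 * (x ^ 5) ^ m) ^ 5 := fun m => by
    have : v ^ (5 * m + 4 + 1) = 1 := by
      rw [show 5 * m + 4 + 1 = 5 * (m + 1) by ring, pow_mul, h5, one_pow]
    rw [this]
    simp only [one_pow, mul_one, Finset.prod_const, Finset.card_range]
    ring
  simp only [Function.comp]
  rw [Finset.prod_comm, prod_range_five_mul, prod_range_five_mul, ← Finset.prod_pow,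
    ← Finset.prod_mul_distrib, ← Finset.prod_mul_distrib]
  refine Finset.prod_congr rfl fun m _ => ?_
  simp only [hF]
  rw [Finset.prod_range_succ, Finset.prod_range_succ _ 4, hF2,
    Finset.prod_congr rfl fun j hj => hF1 (5 * m + j) (by have := Finset.mem_range.1 hj; omega)]
  ring

namespace IsQuinticPair

/-- The trinomial product splits into two `qprod`s with parameters `-ζ²` and its inverse, both with
fifth power `-1`, so `prod_qprod_rotate` applies to each. -/
theorem prod_trinomialProd_rotate {ζ γ : ℂ} (h : IsQuinticPair ζ γ) {x : ℂ} (hx : ‖x‖ < 1) :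
    (∏ k ∈ Finset.range 5, trinomialProd γ ((-ζ) ^ k * x)) * eulerPow ((x ^ 5) ^ 5) 1 ^ 2 =
      eulerPow (x ^ 5) 1 ^ 2 * trinomialProd γ (x ^ 5) ^ 5 := by
  have hv : (-ζ) ^ 4 + (-ζ) ^ 3 + (-ζ) ^ 2 + -ζ + 1 = 0 := by linear_combination h.cyclotomic
  have hv1 : ‖-ζ‖ = 1 := Complex.norm_eq_one_of_pow_eq_one (n := 5)
    (by linear_combination -h.pow_five) (by norm_num)
  have hz2 : -ζ ^ 2 ≠ 0 := neg_ne_zero.2 (pow_ne_zero _ h.ne_zero)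
  have hu : (-ζ ^ 2) ^ 5 = -1 := by linear_combination -(ζ ^ 5 - 1) * h.pow_five
  have hu' : (-ζ ^ 2)⁻¹ ^ 5 = -1 := by rw [inv_pow, hu]; norm_num
  have h1 := prod_qprod_rotate hu hv hx
  have h2 := prod_qprod_rotate hu' hv hx
  rw [Finset.prod_congr rfl fun k _ => trinomialProd_eq hz2 h.eq_add_inv
      (q := (-ζ) ^ k * x) (by simpa [norm_mul, norm_pow, hv1] using hx), Finset.prod_mul_distrib,
    trinomialProd_eq hz2 h.eq_add_inv (norm_pow_five_lt_one hx)]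
  linear_combination (∏ k ∈ Finset.range 5, qprod ((-ζ ^ 2)⁻¹ * ((-ζ) ^ k * x)) ((-ζ) ^ k * x)) *
    eulerPow ((x ^ 5) ^ 5) 1 * h1 +
    eulerPow (x ^ 5) 1 * qprod (-ζ ^ 2 * x ^ 5) (x ^ 5) ^ 5 * h2

theorem quinticTheta_pow_five {ζ γ : ℂ} (h : IsQuinticPair ζ γ) {x : ℂ} (hx : ‖x‖ < 1) :
    quinticTheta ζ (x ^ 5) ^ 5 = quinticB (x ^ 5) ^ 5 - γ ^ 5 * quinticA x ^ 5 := by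
  rcases eq_or_ne x 0 with rfl | hx0
  · rw [zero_pow (by norm_num), h.quinticTheta_zero, quinticA_zero, quinticB_zero]
    ring
  have hv : (-ζ) ^ 4 + (-ζ) ^ 3 + (-ζ) ^ 2 + -ζ + 1 = 0 := by linear_combination h.cyclotomic
  have hv5 : (-ζ) ^ 5 = 1 := by linear_combination -h.pow_five
  have hv1 : ‖-ζ‖ = 1 := Complex.norm_eq_one_of_pow_eq_one hv5 (by norm_num)
  have hrot : ∀ k : ℕ, ‖(-ζ) ^ k * x‖ < 1 := fun k => by
    simpa [norm_mul, norm_pow, hv1] using hx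
  have hrot5 : ∀ k : ℕ, ((-ζ) ^ k * x) ^ 5 = x ^ 5 := fun k => by
    rw [mul_pow, ← pow_mul, mul_comm k, pow_mul, hv5, one_pow, one_mul]
  have hrot0 : ∀ k : ℕ, (-ζ) ^ k * x ≠ 0 := fun k =>
    mul_ne_zero (pow_ne_zero _ (neg_ne_zero.2 h.ne_zero)) hx0
  have hA : ∀ k : ℕ, quinticA ((-ζ) ^ k * x) = (-ζ) ^ k * quinticA x := fun k => by
    rw [quinticA, quinticA, hrot5]; ring
  have hprod : ∏ k ∈ Finset.range 5, quinticTheta ζ ((-ζ) ^ k * x) =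
      quinticB (x ^ 5) ^ 5 - γ ^ 5 * quinticA x ^ 5 := by
    have := prod_add_mul_pow_five hv (quinticB (x ^ 5)) (-γ * quinticA x)
    rw [show quinticB (x ^ 5) ^ 5 - γ ^ 5 * quinticA x ^ 5 =
      quinticB (x ^ 5) ^ 5 + (-γ * quinticA x) ^ 5 by ring, ← this]
    refine Finset.prod_congr rfl fun k _ => ?_
    rw [h.quinticTheta_eq (hrot k), hrot5, hA]
    ring
  have h1 : (∏ k ∈ Finset.range 5, quinticTheta ζ ((-ζ) ^ k * x)) *
      ∏ k ∈ Finset.range 5, trinomialProd γ ((-ζ) ^ k * x) = eulerPow (x ^ 5) 1 ^ 2 := by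
    rw [← Finset.prod_mul_distrib, Finset.prod_congr rfl fun k _ =>
      h.quinticTheta_mul_trinomialProd (hrot k) (hrot0 k)]
    simp only [hrot5, Finset.prod_const, Finset.card_range]
    rw [← eulerPow_nsmul, ← eulerPow_nsmul]
    norm_num
  have h2 : quinticTheta ζ (x ^ 5) ^ 5 * trinomialProd γ (x ^ 5) ^ 5 =
      eulerPow ((x ^ 5) ^ 5) 1 ^ 2 := by
    rw [← mul_pow, h.quinticTheta_mul_trinomialProd (norm_pow_five_lt_one hx) (pow_ne_zero 5 hx0),
      ← eulerPow_nsmul, ← eulerPow_nsmul]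
    norm_num
  have h3 := h.prod_trinomialProd_rotate hx
  rw [← hprod]
  have hE := eulerPow_ne_zero ((x ^ 5) ^ 5) 1
  have hR : ∏ k ∈ Finset.range 5, trinomialProd γ ((-ζ) ^ k * x) ≠ 0 :=
    Finset.prod_ne_zero_iff.2 fun k _ => h.trinomialProd_ne_zero (hrot k)
  -- After multiplication by this nonzero factor, both sides equal `(x⁵;x⁵)_∞²` times
  -- `((x⁵)⁵;(x⁵)⁵)_∞²`.
  refine mul_right_cancel₀ (mul_ne_zero hR (pow_ne_zero 2 hE)) ?_
  linear_combination quinticTheta ζ (x ^ 5) ^ 5 * h3 + eulerPow (x ^ 5) 1 ^ 2 * h2 -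
    eulerPow ((x ^ 5) ^ 5) 1 ^ 2 * h1

end IsQuinticPair

/-! ### The branch of `√t` -/

theorem continuousOn_eulerPow (x : ℂ) :
    ContinuousOn (fun q => eulerPow q x) (Metric.ball 0 1) := by
  intro q₀ hq₀
  obtain ⟨ρ, h0, hρ⟩ := exists_between (mem_ball_zero_iff.1 hq₀)
  have hρ0 : 0 ≤ ρ := (norm_nonneg _).trans h0.le
  refine ContinuousAt.continuousWithinAt ?_
  have hs : Metric.ball (0 : ℂ) ρ ∈ 𝓝 q₀ := Metric.isOpen_ball.mem_nhds (mem_ball_zero_iff.2 h0)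
  have hpow : ∀ n : ℕ, ∀ q ∈ Metric.ball (0 : ℂ) ρ, ‖-q ^ (n + 1)‖ ≤ ρ ^ (n + 1) := fun n q hq => by
    rw [norm_neg, norm_pow]
    exact pow_le_pow_left₀ (norm_nonneg q) (mem_ball_zero_iff.1 hq).le _
  have hle : ∀ n : ℕ, ρ ^ (n + 1) ≤ ρ := fun n => pow_le_of_le_one hρ0 hρ.le n.succ_ne_zero
  refine Complex.continuous_exp.continuousAt.comp (continuousAt_const.mul ?_)
  refine ContinuousOn.continuousAt (s := Metric.ball 0 ρ) ?_ hs
  -- The majorant comes from `|log(1+w)| ≤ |w|²(1-|w|)⁻¹/2 + |w|` with one factor `|w|` bounded by 1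
  -- and `|w| ≤ ρ` in the inverse.
  refine continuousOn_tsum (u := fun n => ρ ^ (n + 1) * ((1 - ρ)⁻¹ / 2 + 1)) (fun n => ?_) ?_ ?_
  · refine ContinuousOn.clog (by fun_prop) fun q hq => ?_
    rw [sub_eq_add_neg]
    exact Complex.mem_slitPlane_of_norm_lt_one ((hpow n q hq).trans_lt ((hle n).trans_lt hρ))
  · exact (((summable_geometric_of_lt_one hρ0 hρ).mul_left ρ).congr fun n => by ring).mul_right _
  · intro n q hq
    have h1 := (hpow n q hq).trans (hle n)
    have h2 : (1 - ‖-q ^ (n + 1)‖)⁻¹ ≤ (1 - ρ)⁻¹ := inv_anti₀ (by linarith) (by linarith)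
    have h3 : 0 ≤ (1 - ρ)⁻¹ := inv_nonneg.2 (by linarith)
    rw [sub_eq_add_neg]
    refine (Complex.norm_log_one_add_le (h1.trans_lt hρ)).trans ?_
    calc ‖-q ^ (n + 1)‖ ^ 2 * (1 - ‖-q ^ (n + 1)‖)⁻¹ / 2 + ‖-q ^ (n + 1)‖
        ≤ ‖-q ^ (n + 1)‖ * (1 * (1 - ρ)⁻¹ / 2 + 1) := by
          rw [sq, mul_assoc, mul_div_assoc, mul_add, mul_one]
          gcongr
          · exact inv_nonneg.2 (by linarith)
          · exact h1.trans hρ.le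
      _ ≤ ρ ^ (n + 1) * ((1 - ρ)⁻¹ / 2 + 1) := by
          rw [one_mul]
          gcongr
          exact hpow n q hq

theorem continuousOn_tsum_neg_one_zpow_mul {e : ℤ → ℤ} (he : ∀ n, |n| ≤ e n) :
    ContinuousOn (fun q : ℂ => ∑' n : ℤ, (-1 : ℂ) ^ n * q ^ e n) (Metric.ball 0 1) := by
  intro q₀ hq₀
  obtain ⟨ρ, h0, hρ⟩ := exists_between (mem_ball_zero_iff.1 hq₀)
  have hρ0 : 0 ≤ ρ := (norm_nonneg _).trans h0.le
  have hs : Metric.ball (0 : ℂ) ρ ∈ 𝓝 q₀ := Metric.isOpen_ball.mem_nhds (mem_ball_zero_iff.2 h0)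
  have hnat : ∀ n, e n = ((e n).toNat : ℤ) := fun n =>
    (Int.toNat_of_nonneg ((abs_nonneg n).trans (he n))).symm
  refine (ContinuousOn.continuousAt (s := Metric.ball 0 ρ) ?_ hs).continuousWithinAt
  refine continuousOn_tsum (u := fun n : ℤ => ρ ^ n.natAbs) (fun n => ?_) ?_ ?_
  · rw [hnat]
    simp only [zpow_natCast]
    fun_prop
  · refine Summable.of_nat_of_neg ?_ ?_ <;>
      simpa using summable_geometric_of_lt_one hρ0 hρ
  · intro n q hq
    rw [hnat, zpow_natCast, norm_mul, norm_zpow, norm_neg, norm_one, one_zpow, one_mul, norm_pow]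
    calc ‖q‖ ^ (e n).toNat ≤ ρ ^ (e n).toNat :=
          pow_le_pow_left₀ (norm_nonneg q) (mem_ball_zero_iff.1 hq).le _
      _ ≤ ρ ^ n.natAbs := pow_le_pow_of_le_one hρ0 hρ.le (by
          have := he n
          rw [Int.abs_eq_natAbs] at this
          omega)

theorem continuousOn_tsum_quinticA : ContinuousOn
    (fun q : ℂ => ∑' n : ℤ, (-1 : ℂ) ^ n * q ^ ((5 * n ^ 2 - 3 * n) / 2)) (Metric.ball 0 1) := by
  refine continuousOn_tsum_neg_one_zpow_mul fun n => ?_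
  have h1 : |n| ≤ n ^ 2 := by
    rw [← sq_abs]; exact Int.le_self_sq _
  rw [Int.le_ediv_iff_mul_le (by norm_num)]
  have := le_abs_self n
  linarith

theorem mapsTo_pow_ball {k : ℕ} (hk : k ≠ 0) :
    Set.MapsTo (fun s : ℂ => s ^ k) (Metric.ball 0 1) (Metric.ball 0 1) := fun s hs => by
  rw [mem_ball_zero_iff, norm_pow]
  exact pow_lt_one₀ (norm_nonneg s) (mem_ball_zero_iff.1 hs) hk

/-- The square root `q^{1/10} (q;q)_∞^{-1/10} (q⁵;q⁵)_∞^{1/2}` of `A(q) B(q)` at `q = s ^ 10`. -/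
def sqrtAB (s : ℂ) : ℂ := s * eulerPow (s ^ 10) (-1 / 10) * eulerPow ((s ^ 10) ^ 5) (1 / 2)

theorem sqrtAB_sq {s : ℂ} (hs0 : s ≠ 0) (hs : ‖s‖ < 1) :
    sqrtAB s ^ 2 = quinticA (s ^ 2) * quinticB (s ^ 10) := by
  have hs2 : ‖s ^ 2‖ < 1 := by rw [norm_pow]; exact pow_lt_one₀ (norm_nonneg s) hs (by norm_num)
  have h := quinticA_mul_quinticB hs2 (pow_ne_zero 2 hs0)
  rw [show (s ^ 2) ^ 5 = s ^ 10 by ring] at h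
  rw [h, sqrtAB, mul_pow, mul_pow, ← eulerPow_nsmul, ← eulerPow_nsmul]
  norm_num

theorem sqrtAB_ne_zero {s : ℂ} (hs0 : s ≠ 0) : sqrtAB s ≠ 0 :=
  mul_ne_zero (mul_ne_zero hs0 (eulerPow_ne_zero _ _)) (eulerPow_ne_zero _ _)

/-- The quotient of `A(q) / √(A(q) B(q))` by `q^{1/10}`, at `q = s ^ 10`. -/
def sqrtTQuot (s : ℂ) : ℂ :=
  eulerPow (s ^ 10) (-3 / 5) *
    (∑' n : ℤ, (-1 : ℂ) ^ n * (s ^ 10) ^ ((5 * n ^ 2 - 3 * n) / 2)) /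
    (eulerPow (s ^ 10) (-1 / 10) * eulerPow ((s ^ 10) ^ 5) (1 / 2))

/-- The origin is included: this gives both the continuity of the branch and, with `sqrtTQuot_zero`,
its normalization at 0. -/
theorem continuousOn_sqrtTQuot : ContinuousOn sqrtTQuot (Metric.ball 0 1) := by
  have h10 : ContinuousOn (fun s : ℂ => s ^ 10) (Metric.ball 0 1) := by fun_prop
  have hm := mapsTo_pow_ball (k := 10) (by norm_num)
  have hm5 := (mapsTo_pow_ball (k := 5) (by norm_num)).comp hm
  have h50 : ContinuousOn (fun s : ℂ => (s ^ 10) ^ 5) (Metric.ball 0 1) := by fun_prop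
  refine ContinuousOn.div (((continuousOn_eulerPow _).comp h10 hm).mul
    (continuousOn_tsum_quinticA.comp h10 hm)) (((continuousOn_eulerPow _).comp h10 hm).mul
    ((continuousOn_eulerPow _).comp h50 hm5)) fun s _ =>
      mul_ne_zero (eulerPow_ne_zero _ _) (eulerPow_ne_zero _ _)

theorem sqrtTQuot_zero : sqrtTQuot 0 = 1 := by
  have h1 : ∑' n : ℤ, (-1 : ℂ) ^ n * (0 : ℂ) ^ ((5 * n ^ 2 - 3 * n) / 2) = 1 := by
    rw [tsum_eq_single 0]
    · simp
    · intro n hn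
      rw [zero_zpow _ (ne_of_gt ?_), mul_zero]
      have h2 : |n| ≤ n ^ 2 := by rw [← sq_abs]; exact Int.le_self_sq _
      have h3 := le_abs_self n
      have h4 := abs_pos.2 hn
      omega
  rw [sqrtTQuot, zero_pow (by norm_num), h1]
  simp [eulerPow]

theorem mul_sqrtTQuot {s : ℂ} (hs0 : s ≠ 0) : s * sqrtTQuot s = quinticA (s ^ 2) / sqrtAB s := by
  have h1 := eulerPow_ne_zero (s ^ 10) (-1 / 10)
  have h2 := eulerPow_ne_zero ((s ^ 10) ^ 5) (1 / 2)
  rw [sqrtTQuot, sqrtAB, quinticA, show (s ^ 2) ^ 5 = s ^ 10 by ring]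
  field_simp

theorem quinticA_ne_zero {r : ℂ} (hr0 : r ≠ 0) (hr : ‖r‖ < 1) : quinticA r ≠ 0 := fun h0 => by
  have h := quinticA_mul_quinticB hr hr0
  rw [h0, zero_mul] at h
  exact mul_ne_zero (mul_ne_zero hr0 (eulerPow_ne_zero _ _)) (eulerPow_ne_zero _ _) h.symm

theorem quinticB_ne_zero {r : ℂ} (hr0 : r ≠ 0) (hr : ‖r‖ < 1) : quinticB (r ^ 5) ≠ 0 := fun h0 => by
  have h := quinticA_mul_quinticB hr hr0
  rw [h0, mul_zero] at h
  exact mul_ne_zero (mul_ne_zero hr0 (eulerPow_ne_zero _ _)) (eulerPow_ne_zero _ _) h.symm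

theorem isSqrtT_mul_sqrtTQuot : IsSqrtT fun s => s * sqrtTQuot s := by
  refine ⟨continuousOn_id.mul (continuousOn_sqrtTQuot.mono fun s hs => ?_), fun s hs0 hs => ?_, ?_⟩
  · exact mem_ball_zero_iff.2 hs.2
  · have hs0' := norm_pos_iff.1 hs0
    have hs2 : ‖s ^ 2‖ < 1 := by rw [norm_pow]; exact pow_lt_one₀ (norm_nonneg s) hs (by norm_num)
    have hA := quinticA_ne_zero (pow_ne_zero 2 hs0') hs2
    change (s * sqrtTQuot s) ^ 2 = _
    rw [mul_sqrtTQuot hs0', div_pow, sqrtAB_sq hs0' hs, rrT, show (s ^ 2) ^ 5 = s ^ 10 by ring, sq,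
      mul_div_mul_left _ _ hA]
  · have h : Tendsto sqrtTQuot (𝓝[≠] 0) (𝓝 1) := by
      rw [← sqrtTQuot_zero]
      exact ((continuousOn_sqrtTQuot.continuousAt (Metric.ball_mem_nhds 0 one_pos)).tendsto).mono_left
        nhdsWithin_le_nhds
    refine h.congr' ?_
    filter_upwards [self_mem_nhdsWithin] with s hs
    rw [mul_div_cancel_left₀ _ hs]

theorem isPreconnected_punctured_disc : IsPreconnected {s : ℂ | 0 < ‖s‖ ∧ ‖s‖ < 1} := by
  have h : {s : ℂ | 0 < ‖s‖ ∧ ‖s‖ < 1} = Complex.exp '' {z | z.re < 0} := by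
    ext s
    simp only [Set.mem_ofPred_eq, Set.mem_image]
    constructor
    · rintro ⟨h0, h1⟩
      exact ⟨Complex.log s, by rw [Complex.log_re]; exact Real.log_neg h0 h1,
        Complex.exp_log (norm_pos_iff.1 h0)⟩
    · rintro ⟨z, hz, rfl⟩
      rw [Complex.norm_exp]
      exact ⟨Real.exp_pos _, Real.exp_lt_one_iff.2 hz⟩
  rw [h]
  exact (convex_halfSpace_re_lt 0).isPreconnected.image _ Complex.continuous_exp.continuousOn

/-- The branch of `√t` is unique. -/
theorem IsSqrtT.eq {w : ℂ → ℂ} (hw : IsSqrtT w) {s : ℂ} (hs0 : s ≠ 0) (hs : ‖s‖ < 1) :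
    w s = quinticA (s ^ 2) / sqrtAB s := by
  obtain ⟨hc, hsq, hlim⟩ := hw
  obtain ⟨hc', hsq', hlim'⟩ := isSqrtT_mul_sqrtTQuot
  have hne : ∀ {s : ℂ}, s ∈ {s : ℂ | 0 < ‖s‖ ∧ ‖s‖ < 1} → s * sqrtTQuot s ≠ 0 := fun {s} hs => by
    have hs0 := norm_pos_iff.1 hs.1
    rw [mul_sqrtTQuot hs0]
    refine div_ne_zero (quinticA_ne_zero (pow_ne_zero 2 hs0) ?_) (sqrtAB_ne_zero hs0)
    rw [norm_pow]
    exact pow_lt_one₀ (norm_nonneg s) hs.2 (by norm_num)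
  rw [← mul_sqrtTQuot hs0]
  -- Two continuous square roots of a nonvanishing function on a connected set differ by a global
  -- sign; the limit of `w s / s` at 0 rules out `-1`.
  rcases isPreconnected_punctured_disc.eq_or_eq_neg_of_sq_eq hc hc'
    (fun s hs => (hsq s hs.1 hs.2).trans (hsq' s hs.1 hs.2).symm) hne with h | h
  · exact h ⟨norm_pos_iff.2 hs0, hs⟩
  · exfalso
    have hev : ∀ᶠ s : ℂ in 𝓝[≠] 0, w s / s = -(s * sqrtTQuot s / s) := by
      filter_upwards [self_mem_nhdsWithin,
        mem_nhdsWithin_of_mem_nhds (Metric.ball_mem_nhds (0 : ℂ) one_pos)] with s h0 h1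
      rw [h ⟨norm_pos_iff.2 h0, mem_ball_zero_iff.1 h1⟩, Pi.neg_apply, neg_div]
    have h1 := tendsto_nhds_unique (hlim.congr' hev) hlim'.neg
    norm_num at h1

/-! ### Equivalence with Ramanujan's identities -/

namespace IsQuinticPair

theorem multipliable_trinomial {ζ γ : ℂ} (h : IsQuinticPair ζ γ) {q : ℂ} (hq : ‖q‖ < 1) :
    Multipliable fun n : ℕ => 1 + γ * q ^ (n + 1) + q ^ (2 * (n + 1)) := by
  have hz : -ζ ^ 2 ≠ 0 := neg_ne_zero.2 (pow_ne_zero _ h.ne_zero)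
  have := (hasProd_trinomialProd hz hq).multipliable
  rwa [← h.eq_add_inv] at this

theorem tprod_one_div_trinomial {ζ γ : ℂ} (h : IsQuinticPair ζ γ) {q : ℂ} (hq : ‖q‖ < 1) :
    ∏' n : ℕ, 1 / (1 + γ * q ^ (n + 1) + q ^ (2 * (n + 1))) = (trinomialProd γ q)⁻¹ := by
  simp only [one_div]
  exact (h.multipliable_trinomial hq).tprod_inv₀ (h.trinomialProd_ne_zero hq)

theorem tprod_one_div_trinomial_pow {ζ γ : ℂ} (h : IsQuinticPair ζ γ) {q : ℂ} (hq : ‖q‖ < 1) :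
    ∏' n : ℕ, 1 / (1 + γ * q ^ (n + 1) + q ^ (2 * (n + 1))) ^ 5 = (trinomialProd γ q)⁻¹ ^ 5 := by
  rw [trinomialProd, ← (h.multipliable_trinomial hq).tprod_inv₀ (h.trinomialProd_ne_zero hq),
    ← ((h.multipliable_trinomial hq).inv₀ (h.trinomialProd_ne_zero hq)).tprod_pow]
  simp only [one_div, inv_pow]

/-- Each side of one identity, divided by `sqrtAB s`, is the corresponding side of the other, so the
equivalence does not rest on either being true. -/
theorem linear_iff {ζ γ : ℂ} (h : IsQuinticPair ζ γ) {s : ℂ} (hs0 : s ≠ 0) (hs : ‖s‖ < 1) :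
    quinticTheta ζ (s ^ 2) = quinticB ((s ^ 2) ^ 5) - γ * quinticA (s ^ 2) ↔
      RamanujanLinear γ s (quinticA (s ^ 2) / sqrtAB s) := by
  have hs2 : ‖s ^ 2‖ < 1 := by rw [norm_pow]; exact pow_lt_one₀ (norm_nonneg s) hs (by norm_num)
  have hA := quinticA_ne_zero (pow_ne_zero 2 hs0) hs2
  have hK := sqrtAB_ne_zero hs0
  have hR := h.trinomialProd_ne_zero hs2
  have hG := h.quinticTheta_mul_trinomialProd hs2 (pow_ne_zero 2 hs0)
  have e10 : (s ^ 2) ^ 5 = s ^ 10 := by ring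
  rw [e10] at hG ⊢
  have h1 : 1 / (quinticA (s ^ 2) / sqrtAB s) - γ * (quinticA (s ^ 2) / sqrtAB s) =
      (quinticB (s ^ 10) - γ * quinticA (s ^ 2)) / sqrtAB s := by
    have := sqrtAB_sq hs0 hs
    field_simp
    linear_combination this
  have h2 : s⁻¹ * (eulerPow (s ^ 10) (1 / 2) / eulerPow ((s ^ 10) ^ 5) (1 / 2)) *
      (trinomialProd γ (s ^ 2))⁻¹ = quinticTheta ζ (s ^ 2) / sqrtAB s := by
    have h3 := eulerPow_ne_zero (s ^ 10) (-1 / 10)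
    have h4 := eulerPow_ne_zero ((s ^ 10) ^ 5) (1 / 2)
    rw [eq_div_iff hK, ← mul_left_inj' hR, hG, sqrtAB,
      show (2 / 5 : ℂ) = 1 / 2 + -1 / 10 by norm_num, eulerPow_add]
    generalize eulerPow ((s ^ 10) ^ 5) (1 / 2) = y, eulerPow (s ^ 10) (-1 / 10) = x at *
    field_simp
  rw [RamanujanLinear, h.tprod_one_div_trinomial hs2, h1, h2, div_left_inj' hK]
  exact eq_comm

theorem quintic_iff {ζ γ : ℂ} (h : IsQuinticPair ζ γ) {s : ℂ} (hs0 : s ≠ 0) (hs : ‖s‖ < 1) :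
    quinticTheta ζ (s ^ 10) ^ 5 = quinticB (s ^ 10) ^ 5 - γ ^ 5 * quinticA (s ^ 2) ^ 5 ↔
      RamanujanQuintic γ s (quinticA (s ^ 2) / sqrtAB s) := by
  have hs2 : ‖s ^ 2‖ < 1 := by rw [norm_pow]; exact pow_lt_one₀ (norm_nonneg s) hs (by norm_num)
  have hs10 : ‖s ^ 10‖ < 1 := by rw [norm_pow]; exact pow_lt_one₀ (norm_nonneg s) hs (by norm_num)
  have hA := quinticA_ne_zero (pow_ne_zero 2 hs0) hs2
  have hK := sqrtAB_ne_zero hs0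
  have hR := h.trinomialProd_ne_zero hs10
  have hG := h.quinticTheta_mul_trinomialProd hs10 (pow_ne_zero 10 hs0)
  have h1 : (1 / (quinticA (s ^ 2) / sqrtAB s)) ^ 5 - (γ * (quinticA (s ^ 2) / sqrtAB s)) ^ 5 =
      (quinticB (s ^ 10) ^ 5 - γ ^ 5 * quinticA (s ^ 2) ^ 5) / sqrtAB s ^ 5 := by
    have h3 : 1 / (quinticA (s ^ 2) / sqrtAB s) = quinticB (s ^ 10) / sqrtAB s := by
      have := sqrtAB_sq hs0 hs
      field_simp
      exact this
    rw [h3]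
    ring
  have h2 : (s ^ 5)⁻¹ * (eulerPow (s ^ 10) (1 / 2) / eulerPow ((s ^ 10) ^ 5) (1 / 2)) *
      (trinomialProd γ (s ^ 10))⁻¹ ^ 5 = quinticTheta ζ (s ^ 10) ^ 5 / sqrtAB s ^ 5 := by
    have h3 := eulerPow_ne_zero (s ^ 10) (-1 / 10)
    have h4 := eulerPow_ne_zero ((s ^ 10) ^ 5) (1 / 2)
    -- The powers of `(q;q)_∞` in `sqrtAB s ^ 5` and in the prefactor cancel: `5 · (-1/10) + 1/2 =
    -- 0`.
    have h5 : eulerPow (s ^ 10) (-1 / 10) ^ 5 * eulerPow (s ^ 10) (1 / 2) = 1 := by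
      rw [← eulerPow_nsmul, ← eulerPow_add]
      norm_num [eulerPow]
    have h6 : eulerPow ((s ^ 10) ^ 5) (2 / 5) ^ 5 = eulerPow ((s ^ 10) ^ 5) (1 / 2) ^ 4 := by
      rw [← eulerPow_nsmul, ← eulerPow_nsmul]
      norm_num
    rw [eq_div_iff (pow_ne_zero 5 hK), ← mul_left_inj' (pow_ne_zero 5 hR),
      ← mul_pow (quinticTheta ζ (s ^ 10)), hG, h6, sqrtAB]
    generalize eulerPow ((s ^ 10) ^ 5) (1 / 2) = y, eulerPow (s ^ 10) (-1 / 10) = x at *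
    field_simp
    linear_combination h5
  rw [RamanujanQuintic, h.tprod_one_div_trinomial_pow hs10, h1, h2, div_left_inj' (pow_ne_zero 5 hK)]
  exact eq_comm

end IsQuinticPair

/-! ### Specialization to the golden ratio and its conjugate -/

theorem IsQuinticPair.of_quadratic {ζ γ : ℂ} (hγ : γ ^ 2 = γ + 1)
    (hζ : ζ ^ 2 - (1 - γ) * ζ + 1 = 0) : IsQuinticPair ζ γ := by
  -- The tenth cyclotomic polynomial factors as `(ζ² - (1-γ)ζ + 1)(ζ² - γζ + 1)` when `γ² = γ + 1`.
  have hc : ζ ^ 4 - ζ ^ 3 + ζ ^ 2 - ζ + 1 = 0 := by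
    linear_combination (ζ ^ 2 - γ * ζ + 1) * hζ + ζ ^ 2 * hγ
  refine ⟨hc, ?_⟩
  have h0 : ζ ≠ 0 := by rintro rfl; simp at hζ
  refine mul_right_cancel₀ h0 ?_
  linear_combination hζ - (ζ + 1) * hc

theorem exp_quadratic (θ : ℂ) : Complex.exp (θ * Complex.I) ^ 2 -
    2 * Complex.cos θ * Complex.exp (θ * Complex.I) + 1 = 0 := by
  have h : Complex.exp (-θ * Complex.I) * Complex.exp (θ * Complex.I) = 1 := by
    rw [← Complex.exp_add]; simp
  rw [Complex.two_cos]
  linear_combination -h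

theorem golden_sq : (((1 + √5) / 2 : ℝ) : ℂ) ^ 2 = (((1 + √5) / 2 : ℝ) : ℂ) + 1 := by
  norm_cast
  have := Real.sq_sqrt (show (0 : ℝ) ≤ 5 by norm_num)
  linear_combination this / 4

theorem golden_conj_sq : (((1 - √5) / 2 : ℝ) : ℂ) ^ 2 = (((1 - √5) / 2 : ℝ) : ℂ) + 1 := by
  norm_cast
  have := Real.sq_sqrt (show (0 : ℝ) ≤ 5 by norm_num)
  linear_combination this / 4

theorem isQuinticPair_golden :
    IsQuinticPair (Complex.exp (3 * Real.pi * Complex.I / 5)) (((1 + √5) / 2 : ℝ) : ℂ) := by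
  refine .of_quadratic golden_sq ?_
  have h := exp_quadratic ((3 * Real.pi / 5 : ℝ) : ℂ)
  have hcos : 2 * Real.cos (3 * Real.pi / 5) = 1 - (1 + √5) / 2 := by
    rw [show 3 * Real.pi / 5 = Real.pi - 2 * (Real.pi / 5) by ring, Real.cos_pi_sub,
      Real.cos_two_mul, Real.cos_pi_div_five]
    have := Real.sq_sqrt (show (0 : ℝ) ≤ 5 by norm_num)
    linear_combination -this / 4
  have hcos' : 2 * Complex.cos ((3 * Real.pi / 5 : ℝ) : ℂ) = 1 - (((1 + √5) / 2 : ℝ) : ℂ) := by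
    exact_mod_cast congrArg Complex.ofReal hcos
  rw [hcos', show ((3 * Real.pi / 5 : ℝ) : ℂ) * Complex.I = 3 * Real.pi * Complex.I / 5 by
    push_cast; ring] at h
  exact h

theorem isQuinticPair_golden_conj :
    IsQuinticPair (Complex.exp (Real.pi * Complex.I / 5)) (((1 - √5) / 2 : ℝ) : ℂ) := by
  refine .of_quadratic golden_conj_sq ?_
  have h := exp_quadratic ((Real.pi / 5 : ℝ) : ℂ)
  have hcos : 2 * Real.cos (Real.pi / 5) = 1 - (1 - √5) / 2 := by
    rw [Real.cos_pi_div_five]; ring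
  have hcos' : 2 * Complex.cos ((Real.pi / 5 : ℝ) : ℂ) = 1 - (((1 - √5) / 2 : ℝ) : ℂ) := by
    exact_mod_cast congrArg Complex.ofReal hcos
  rw [hcos', show ((Real.pi / 5 : ℝ) : ℂ) * Complex.I = Real.pi * Complex.I / 5 by
    push_cast; ring] at h
  exact h

theorem quinticC_eq (q : ℂ) :
    quinticC q = quinticTheta (Complex.exp (3 * Real.pi * Complex.I / 5)) q := by
  rw [quinticC, quinticTheta]
  congr 1
  refine tsum_congr fun n => ?_
  rw [thetaTerm, ← Complex.exp_int_mul]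
  congr 2
  ring

theorem quinticD_eq (q : ℂ) :
    quinticD q = quinticTheta (Complex.exp (Real.pi * Complex.I / 5)) q := by
  rw [quinticD, quinticTheta]
  congr 1
  refine tsum_congr fun n => ?_
  rw [thetaTerm, ← Complex.exp_int_mul]
  congr 2
  ring

end

theorem theorem1p1 (α β : ℂ)
    (hα : α = (((1 + Real.sqrt 5) / 2 : ℝ) : ℂ)) (hβ : β = (((1 - Real.sqrt 5) / 2 : ℝ) : ℂ)) :
    -- the quintic identities, for every choice `r` of the fifth root `q^{1/5}`
    (∀ q r : ℂ, ‖q‖ < 1 → r ^ 5 = q →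
      quinticC q ^ 5 = quinticB q ^ 5 - α ^ 5 * quinticA r ^ 5 ∧
      quinticD q ^ 5 = quinticB q ^ 5 - β ^ 5 * quinticA r ^ 5) ∧
    -- the linear identities, where `A(q⁵)` is taken with `(q⁵)^{1/5} = q`
    (∀ q : ℂ, ‖q‖ < 1 →
      quinticC q = quinticB (q ^ 5) - α * quinticA q ∧
      quinticD q = quinticB (q ^ 5) - β * quinticA q) ∧
    -- `t = A/B` is well defined and nonzero, and the required branch of its square root exists
    (∀ r : ℂ, 0 < ‖r‖ → ‖r‖ < 1 → quinticA r ≠ 0 ∧ quinticB (r ^ 5) ≠ 0) ∧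
    (∃ w : ℂ → ℂ, IsSqrtT w) ∧
    -- Ramanujan's identities hold, and each is equivalent to one of the four identities above
    (∀ w : ℂ → ℂ, IsSqrtT w → ∀ s : ℂ, 0 < ‖s‖ → ‖s‖ < 1 →
      (RamanujanLinear α s (w s) ∧ RamanujanLinear β s (w s) ∧
        RamanujanQuintic α s (w s) ∧ RamanujanQuintic β s (w s)) ∧
      (quinticC (s ^ 2) = quinticB ((s ^ 2) ^ 5) - α * quinticA (s ^ 2) ↔
        RamanujanLinear α s (w s)) ∧
      (quinticD (s ^ 2) = quinticB ((s ^ 2) ^ 5) - β * quinticA (s ^ 2) ↔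
        RamanujanLinear β s (w s)) ∧
      (quinticC (s ^ 10) ^ 5 = quinticB (s ^ 10) ^ 5 - α ^ 5 * quinticA (s ^ 2) ^ 5 ↔
        RamanujanQuintic α s (w s)) ∧
      (quinticD (s ^ 10) ^ 5 = quinticB (s ^ 10) ^ 5 - β ^ 5 * quinticA (s ^ 2) ^ 5 ↔
        RamanujanQuintic β s (w s))) := by
  subst hα hβ
  have hp := isQuinticPair_golden
  have hm := isQuinticPair_golden_conj
  simp only [quinticC_eq, quinticD_eq]
  refine ⟨?_, fun q hq => ⟨hp.quinticTheta_eq hq, hm.quinticTheta_eq hq⟩,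
    fun r hr0 hr => ⟨quinticA_ne_zero (norm_pos_iff.1 hr0) hr,
      quinticB_ne_zero (norm_pos_iff.1 hr0) hr⟩, ⟨_, isSqrtT_mul_sqrtTQuot⟩, ?_⟩
  · rintro q r hq rfl
    have hr : ‖r‖ < 1 := by
      rw [norm_pow] at hq
      exact (pow_lt_one_iff_of_nonneg (norm_nonneg r) (by norm_num)).1 hq
    exact ⟨hp.quinticTheta_pow_five hr, hm.quinticTheta_pow_five hr⟩
  · intro w hw s hs0' hs
    have hs0 := norm_pos_iff.1 hs0'
    have hs2 : ‖s ^ 2‖ < 1 := by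
      rw [norm_pow]; exact pow_lt_one₀ (norm_nonneg s) hs (by norm_num)
    have hq := hp.quinticTheta_pow_five hs2
    have hq' := hm.quinticTheta_pow_five hs2
    rw [show (s ^ 2) ^ 5 = s ^ 10 by ring] at hq hq'
    rw [hw.eq hs0 hs]
    exact ⟨⟨(hp.linear_iff hs0 hs).1 (hp.quinticTheta_eq hs2),
      (hm.linear_iff hs0 hs).1 (hm.quinticTheta_eq hs2),
      (hp.quintic_iff hs0 hs).1 hq, (hm.quintic_iff hs0 hs).1 hq'⟩,
      hp.linear_iff hs0 hs, hm.linear_iff hs0 hs, hp.quintic_iff hs0 hs, hm.quintic_iff hs0 hs⟩
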